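/- Let $G$ be a finite directed graph with vertex set $V(G)$ and edge set $E(G)$; loops and multiple edges are allowed. A directed cycle in $G$ is a sequence $v_0,x_0,v_1,x_1,\dots,v_n,x_n,v_{n+1}=v_0$ ($n\ge 0$), taken up to cyclic rotation, where $v_0,\dots,v_n$ are pairwise distinct vertices and each $x_i$ is an edge from $v_i$ to $v_{i+1}$. For a vertex $u$ with outgoing edges $x_1,\dots,x_m$ and incoming edges $y_1,\dots,y_n$ put $k_u=\max\{m,n\}$ and, for $1\le l\le k_u$, $$\delta_{u,l}=e_l(x_1,\dots,x_m)-e_l(y_1,\dots,y_n)\in\mathbb Z[E(G)],$$ where $e_l$ is the $l$-th elementary symmetric polynomial ($e_l=0$ if $l$ exceeds the number of variables). Let $I(G)\subset\mathbb Z[E(G)]$ be the ideal generated by all $\delta_{u,l}$, $u\in V(G)$, $1\le l\le k_u$. Let $\mathscr C_*(G)$ be the Koszul chain complex over $\mathbb Z[E(G)]$ of the family $(\delta_{u,l})_{u,l}$, let $\mathscr H_*(G)$ be its homology, and let $\mathscr H^{\mathbb Q}_*(G)$ be the homology of $\mathbb Q\otimes_{\mathbb Z}\mathscr C_*(G)$.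 For a commutative ring $R$ and an $R$-module $M$ put $\operatorname{Kdim}_R M=\operatorname{Kdim}(R/\operatorname{ann}_R M)$, the Krull dimension of the ring $R/\operatorname{ann}_R M$. Let $v$ be a vertex of $G$ and let $E(v)$ be the set of edges incident at $v$. Let $\alpha_v(G)$ be the maximal number of pairwise edge-disjoint directed cycles in $G$ each of which contains $v$, and let $\beta_v(G)$ be the minimal number of edges in $E(v)$ whose removal from $G$ destroys all directed cycles containing $v$. 1. The following statements are equivalent: (1) there are no directed cycles in $G$ containing $v$; (2) $\mathbb Z[E(v)]/\operatorname{ann}_{\mathbb Z[E(v)]}(\mathscr H_0(G))$ is a finitely generated $\mathbb Z$-module; (3) $\mathbb Z[E(v)]/\operatorname{ann}_{\mathbb Z[E(v)]}(\mathscr H_*(G))$ is a finitely generated $\mathbb Z$-module; (4) there is an $n\ge 1$ such that $x^n\in I(G)$ for all $x\in E(v)$; (5) $\operatorname{Kdim}_{\mathbb Z[E(v)]}\mathscr H_0(G)=1$; (6) $\operatorname{Kdim}_{\mathbb Q[E(v)]}\mathscr H^{\mathbb Q}_0(G)=0$. 2. $\alpha_v(G)\le \operatorname{Kdim}_{\mathbb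 Q[E(v)]}\mathscr H_0^{\mathbb Q}(G)\le \operatorname{Kdim}_{\mathbb Z[E(v)]}\mathscr H_0(G)-1\le\beta_v(G)$. -/

import Mathlib

open CategoryTheory

universe u w

/-- A directed graph with vertex set `V` and edge set `E`.  Loops and multiple edges are allowed. -/
structure DirectedGraph (V : Type u) (E : Type w) where
  /-- initial vertex of an edge -/
  init : E → V
  /-- terminal vertex of an edge -/
  term : E → V

/-- A directed cycle `v₀, x₀, v₁, x₁, …, vₙ, xₙ, v₀`: pairwise distinct vertices, and `xᵢ` is an
edge from `vᵢ` to `vᵢ₊₁`.  The index `i + 1` is computed cyclically in `Fin (n + 1)`; for `n = 0`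
this is a loop.  The term records the cyclic sequence together with its starting point. -/
structure DirectedCycle {V : Type u} {E : Type w} (G : DirectedGraph V E) where
  n : ℕ
  vertex : Fin (n + 1) → V
  edge : Fin (n + 1) → E
  vertex_injective : Function.Injective vertex
  init_edge : ∀ i, G.init (edge i) = vertex i
  term_edge : ∀ i, G.term (edge i) = vertex (i + 1)

namespace DirectedCycle

variable {V : Type u} {E : Type w} {G : DirectedGraph V E}

/-- The directed cycle contains the vertex `v`. -/
def Contains (C : DirectedCycle G) (v : V) : Prop := ∃ i, C.vertex i = v

/-- The set of edges of a directed cycle. -/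
def edgeSet (C : DirectedCycle G) : Set E := Set.range C.edge

end DirectedCycle

namespace DirectedGraph

variable {V : Type u} {E : Type w}

/-- The set `E(v)` of all edges incident at `v`. -/
def incidentEdges (G : DirectedGraph V E) (v : V) : Set E := {x | G.init x = v ∨ G.term x = v}

/-- The graph obtained by removing the edges in `S`. -/
def deleteEdges (G : DirectedGraph V E) (S : Set E) : DirectedGraph V {x : E // x ∉ S} where
  init x := G.init x
  term x := G.term x

/-- No directed cycle of `G` contains `v`. -/
def NoCycleThrough (G : DirectedGraph V E) (v : V) : Prop :=
  ¬ ∃ C : DirectedCycle G, C.Contains v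

/-- `α_v(G)`: the maximal number of pairwise edge-disjoint directed cycles containing `v`.
Edge-disjoint directed cycles are automatically distinct, also up to rotation, because a
directed cycle and its rotations have the same non-empty edge set. -/
noncomputable def alpha (G : DirectedGraph V E) (v : V) : ℕ :=
  sSup {k : ℕ | ∃ C : Fin k → DirectedCycle G,
    (∀ i, (C i).Contains v) ∧ Pairwise fun i j => Disjoint (C i).edgeSet (C j).edgeSet}

/-- `β_v(G)`: the minimal number of edges incident at `v` whose removal from `G` destroys all
directed cycles containing `v`. -/
noncomputable def beta (G : DirectedGraph V E) (v : V) : ℕ :=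
  sInf {k : ℕ | ∃ S : Finset E, (S : Set E) ⊆ G.incidentEdges v ∧ S.card = k ∧
    (G.deleteEdges (S : Set E)).NoCycleThrough v}

end DirectedGraph

/-- The `l`-th elementary symmetric polynomial in the variables belonging to `S`. -/
noncomputable def esymmOn {E : Type w} (S : Finset E) (l : ℕ) : MvPolynomial E ℤ :=
  ∑ T ∈ S.powersetCard l, ∏ x ∈ T, MvPolynomial.X x

namespace DirectedGraph

variable {V : Type u} {E : Type w} [Fintype E] [DecidableEq V]

/-- The edges with initial vertex `v`. -/
def outEdges (G : DirectedGraph V E) (v : V) : Finset E := Finset.univ.filter fun x => G.init x = v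

/-- The edges with terminal vertex `v`. -/
def inEdges (G : DirectedGraph V E) (v : V) : Finset E := Finset.univ.filter fun x => G.term x = v

/-- `k_v`, the maximum of the out-degree and the in-degree of `v`. -/
def kmax (G : DirectedGraph V E) (v : V) : ℕ := max (G.outEdges v).card (G.inEdges v).card

/-- The index set of `Δ_G`: the pair `⟨v, l⟩` stands for `δ_{v, l + 1}`, where `1 ≤ l + 1 ≤ k_v`. -/
abbrev RelIndex (G : DirectedGraph V E) : Type u := Σ v : V, Fin (G.kmax v)

/-- The family `Δ_G` of all incidence relations. -/
noncomputable def incidenceRel (G : DirectedGraph V E) (p : G.RelIndex) : MvPolynomial E ℤ :=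
  esymmOn (G.outEdges p.1) (p.2 + 1) - esymmOn (G.inEdges p.1) (p.2 + 1)

/-- The incidence ideal `I(G)` of `ℤ[E(G)]`. -/
noncomputable def incidenceIdeal (G : DirectedGraph V E) : Ideal (MvPolynomial E ℤ) :=
  Ideal.span (Set.range G.incidenceRel)

end DirectedGraph

section Koszul

variable {R : Type w} [CommRing R] {ι : Type u}

/-- Contraction by a linear form maps `⋀ⁿ⁺¹ M` to `⋀ⁿ M`. -/
theorem contractLeft_mem_exteriorPower {M : Type*} [AddCommGroup M] [Module R M]
    (f : Module.Dual R M) (n : ℕ) (x : ExteriorAlgebra R M) (hx : x ∈ ⋀[R]^(n + 1) M) :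
    (CliffordAlgebra.contractLeft (Q := (0 : QuadraticForm R M)) f x : ExteriorAlgebra R M) ∈
      ⋀[R]^n M := by
  unfold ExteriorAlgebra.exteriorPower at hx ⊢
  induction n generalizing x with
  | zero =>
    rw [zero_add, pow_one] at hx
    obtain ⟨m, rfl⟩ := hx
    rw [ExteriorAlgebra.ι, CliffordAlgebra.contractLeft_ι, pow_zero]
    exact Submodule.algebraMap_mem _
  | succ n ih =>
    rw [pow_succ'] at hx
    refine Submodule.mul_induction_on hx ?_ ?_
    · rintro _ ⟨m, rfl⟩ b hb
      rw [ExteriorAlgebra.ι, CliffordAlgebra.contractLeft_ι_mul]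
      refine Submodule.sub_mem _ (Submodule.smul_mem _ _ hb) ?_
      rw [pow_succ']
      exact Submodule.mul_mem_mul ⟨m, rfl⟩ (ih b hb)
    · intro a b ha hb
      rw [map_add]
      exact Submodule.add_mem _ ha hb

/-- The Koszul boundary map `⋀ⁿ⁺¹ F → ⋀ⁿ F` on the free module `F` with basis `(e_i)`:
contraction by the linear form `e_i ↦ r i`, that is,
`e_{i₀} ∧ ⋯ ∧ e_{iₙ} ↦ ∑ j, (-1)^j r_{i_j} e_{i₀} ∧ ⋯ (omit e_{i_j}) ⋯ ∧ e_{iₙ}`. -/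
noncomputable def koszulD (r : ι → R) (n : ℕ) :
    ⋀[R]^(n + 1) (ι →₀ R) →ₗ[R] ⋀[R]^n (ι →₀ R) :=
  (CliffordAlgebra.contractLeft (Q := (0 : QuadraticForm R (ι →₀ R)))
    (Finsupp.linearCombination R r)).restrict
      (contractLeft_mem_exteriorPower (Finsupp.linearCombination R r) n)

theorem koszulD_comp (r : ι → R) (n : ℕ) : koszulD r n ∘ₗ koszulD r (n + 1) = 0 := by
  refine LinearMap.ext fun x => Subtype.ext ?_
  exact CliffordAlgebra.contractLeft_contractLeft _ (x : ExteriorAlgebra R (ι →₀ R))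

/-- The Koszul chain complex of the family `r`, i.e. the tensor product over `R` of the two-term
complexes `0 → R --(r i)--> R → 0`, with its standard basis `e_S`, `S ⊆ ι` finite. -/
noncomputable def koszulComplex (r : ι → R) : ChainComplex (ModuleCat.{max u w} R) ℕ :=
  ChainComplex.of (fun n => ModuleCat.of R (⋀[R]^n (ι →₀ R)))
    (fun n => ModuleCat.ofHom (koszulD r n))
    (fun n => by rw [← ModuleCat.ofHom_comp, koszulD_comp]; rfl)

end Koszul

/-- For a ring homomorphism `φ : S → R` and an `R`-module `M`, the annihilator in `S` of `M`
regarded as an `S`-module through `φ`, namely `{s | φ s • m = 0 for all m ∈ M}`. -/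
noncomputable def annVia {S R : Type*} [CommRing S] [CommRing R] (φ : S →+* R)
    (M : Type*) [AddCommGroup M] [Module R M] : Ideal S :=
  (Module.annihilator R M).comap φ

theorem mem_annVia {S R : Type*} [CommRing S] [CommRing R] (φ : S →+* R)
    (M : Type*) [AddCommGroup M] [Module R M] (s : S) :
    s ∈ annVia φ M ↔ ∀ m : M, φ s • m = 0 := by
  simp [annVia, Module.mem_annihilator]

/-- The Krull dimension `Kdim_S M` of `M` regarded as an `S`-module through `φ`. -/
noncomputable def krullDimVia {S R : Type*} [CommRing S] [CommRing R] (φ : S →+* R)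
    (M : Type*) [AddCommGroup M] [Module R M] : WithBot ℕ∞ :=
  ringKrullDim (S ⧸ annVia φ M)

/-- The inclusion `k[F] → k[E]` of polynomial rings for a subset `F` of `E`. -/
noncomputable def polyIncl {E : Type w} (k : Type) [CommRing k] (F : Set E) :
    MvPolynomial F k →+* MvPolynomial E k :=
  (MvPolynomial.rename (Subtype.val : F → E)).toRingHom

namespace DirectedGraph

variable {V : Type u} {E : Type w} [Fintype E] [DecidableEq V]

/-- The Khovanov–Rozansky chain complex over `ℤ[E(G)]`. -/
noncomputable def krComplex (G : DirectedGraph V E) :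
    ChainComplex (ModuleCat.{max u w} (MvPolynomial E ℤ)) ℕ :=
  koszulComplex G.incidenceRel

/-- The rational Khovanov–Rozansky chain complex `ℚ ⊗_ℤ C(G)`, written as
`ℚ[E(G)] ⊗_{ℤ[E(G)]} C(G)`; recall `ℚ[E(G)] = ℚ ⊗_ℤ ℤ[E(G)]`. -/
noncomputable def krComplexRat (G : DirectedGraph V E) :
    ChainComplex (ModuleCat.{max u w} (MvPolynomial E ℚ)) ℕ :=
  ((ModuleCat.extendScalars.{w, w, max u w}
    (MvPolynomial.map (σ := E) (Int.castRingHom ℚ))).mapHomologicalComplex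
      (ComplexShape.down ℕ)).obj G.krComplex

/-- The Khovanov–Rozansky homology in homological degree `n`. -/
noncomputable abbrev krHomology (G : DirectedGraph V E) (n : ℕ) :
    ModuleCat.{max u w} (MvPolynomial E ℤ) :=
  G.krComplex.homology n

/-- The total Khovanov–Rozansky homology, the direct sum over all homological degrees. -/
abbrev krHomologyTotal (G : DirectedGraph V E) : Type (max u w) :=
  DirectSum ℕ fun n => G.krHomology n

/-- The rational Khovanov–Rozansky homology in homological degree `n`. -/
noncomputable abbrev krHomologyRat (G : DirectedGraph V E) (n : ℕ) :
    ModuleCat.{max u w} (MvPolynomial E ℚ) :=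
  G.krComplexRat.homology n

/-- `ann_{ℤ[E(v)]} H_0(G)`. -/
noncomputable def annZero (G : DirectedGraph V E) (v : V) :
    Ideal (MvPolynomial (G.incidentEdges v) ℤ) :=
  annVia (polyIncl ℤ (G.incidentEdges v)) (G.krHomology 0)

/-- `ann_{ℤ[E(v)]} H_*(G)`. -/
noncomputable def annTotal (G : DirectedGraph V E) (v : V) :
    Ideal (MvPolynomial (G.incidentEdges v) ℤ) :=
  annVia (polyIncl ℤ (G.incidentEdges v)) G.krHomologyTotal

/-- `Kdim_{ℤ[E(v)]} H_0(G)`. -/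
noncomputable def kdimInt (G : DirectedGraph V E) (v : V) : WithBot ℕ∞ :=
  krullDimVia (polyIncl ℤ (G.incidentEdges v)) (G.krHomology 0)

/-- `Kdim_{ℚ[E(v)]} H_0^ℚ(G)`. -/
noncomputable def kdimRat (G : DirectedGraph V E) (v : V) : WithBot ℕ∞ :=
  krullDimVia (polyIncl ℚ (G.incidentEdges v)) (G.krHomologyRat 0)

end DirectedGraph

/-! The annihilator of `H_0` is `I(G)`, and `I(G)` kills every `H_n`, so the statements concern the
quotient of `ℤ[E(v)]` by the contraction of `I(G)`, and its rational analogue.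

A ring map `φ` from `ℤ[E]` to a field kills `I(G)` exactly when, at each vertex, the products `∏ (1
+ φ(x) T)` over outgoing and over incoming edges agree, that is, when each nonzero value is taken
equally often on both sides. The level set of a nonzero value is then balanced at every vertex, and
a balanced edge set containing an edge at `v` contains a cycle through `v`.

Upper bound: if deleting `S` destroys the cycles through `v`, then at every such point an edge `x`
at `v` has value `0` or a value taken on `S`. So `x ∏ (x - s)` lies in the radical of `I(G)`, the
quotient is integral over `ℤ[S]`, and its dimension is at most `|S| + 1`. For `S = ∅` the edges at
`v` are nilpotent modulo `I(G)`; this drives the equivalences.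

Lower bound: giving the edges of the `i`-th of `k` disjoint cycles through `v` the value `X_i` maps
the rational quotient onto `ℚ[X_1, …, X_k]`.

Middle inequality: primes of the rational quotient contract injectively to primes meeting `ℤ` in
`0`. By the Nullstellensatz over `ℤ` these are not maximal, so every chain gains a step. -/

/-! ### Closed walks and cycles in balanced edge sets -/

namespace DirectedGraph

variable {V : Type u} {E : Type w}

/-- `e 0, …, e n` are the edges of a closed walk based at `v` with all edges in `F`. -/
def IsClosedWalk (G : DirectedGraph V E) (F : Set E) (v : V) (n : ℕ) (e : ℕ → E) : Prop :=
  G.init (e 0) = v ∧ G.term (e n) = v ∧ (∀ i ≤ n, e i ∈ F) ∧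
    ∀ i < n, G.term (e i) = G.init (e (i + 1))

/-- A closed walk with a repeated vertex can be shortened. -/
theorem IsClosedWalk.shorten {G : DirectedGraph V E} {F : Set E} {v : V} {n : ℕ} {e : ℕ → E}
    (h : G.IsClosedWalk F v n e) {i j : ℕ} (hij : i < j) (hj : j ≤ n)
    (heq : G.init (e i) = G.init (e j)) :
    G.IsClosedWalk F v (n - (j - i)) fun k => if k < i then e k else e (k + (j - i)) := by
  obtain ⟨h0, hn, hF, hs⟩ := h
  refine ⟨?_, ?_, fun k hk => ?_, fun k hk => ?_⟩
  · by_cases hi : 0 < i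
    · simpa [hi] using h0
    · obtain rfl : i = 0 := by omega
      simp [← heq, h0]
  · have : ¬ n - (j - i) < i := by omega
    simp only [this, if_false]
    rwa [Nat.sub_add_cancel (by omega)]
  · dsimp only
    split_ifs
    · exact hF k (by omega)
    · exact hF _ (by omega)
  · rcases lt_trichotomy (k + 1) i with h | h | h
    · simp only [h, if_true, show k < i by omega]
      exact hs k (by omega)
    · have h1 : k < i := by omega
      have h2 : ¬ k + 1 < i := by omega
      simp only [h1, h2, if_true, if_false]
      rw [hs k (by omega), h, heq]
      congr 2
      omega
    · have h1 : ¬ k < i := by omega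
      have h2 : ¬ k + 1 < i := by omega
      simp only [h1, h2, if_false]
      rw [hs _ (by omega)]
      congr 2
      omega

/-- A closed walk based at `v` yields a directed cycle containing `v`. -/
theorem IsClosedWalk.exists_cycle {G : DirectedGraph V E} {F : Set E} {v : V} {n : ℕ} {e : ℕ → E}
    (h : G.IsClosedWalk F v n e) :
    ∃ C : DirectedCycle G, C.Contains v ∧ C.edgeSet ⊆ F := by
  classical
  have hex : ∃ n e, G.IsClosedWalk F v n e := ⟨n, e, h⟩
  obtain ⟨e, he⟩ := Nat.find_spec hex
  -- A shortest closed walk repeats no initial vertex, since a repetition could be cut out.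
  set m := Nat.find hex with hm
  have hne : ∀ i j, i < j → j ≤ m → G.init (e i) ≠ G.init (e j) := fun i j hij hj heq =>
    Nat.find_min hex (show m - (j - i) < m by omega) ⟨_, he.shorten hij hj heq⟩
  refine ⟨⟨m, fun i => G.init (e i), fun i => e i, ?_, fun _ => rfl, ?_⟩, ⟨0, he.1⟩, ?_⟩
  · intro i j hij
    rcases lt_trichotomy i j with h | h | h
    · exact absurd hij (hne i j h (by omega))
    · exact h
    · exact absurd hij.symm (hne j i h (by omega))
  · intro i
    rcases Fin.eq_castSucc_or_eq_last i with ⟨i, rfl⟩ | rfl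
    · simpa using he.2.2.2 i i.2
    · simpa [he.1] using he.2.1
  · rintro _ ⟨i, rfl⟩
    exact he.2.2.1 i (Nat.lt_succ_iff.1 i.2)

/-- One-step reachability by an edge in `F`. -/
def Step (G : DirectedGraph V E) (F : Set E) (a b : V) : Prop :=
  ∃ x ∈ F, G.init x = a ∧ G.term x = b

theorem exists_walk_of_transGen {G : DirectedGraph V E} {F : Set E} {a b : V}
    (h : Relation.TransGen (G.Step F) a b) :
    ∃ (n : ℕ) (e : ℕ → E), G.init (e 0) = a ∧ G.term (e n) = b ∧ (∀ i ≤ n, e i ∈ F) ∧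
      ∀ i < n, G.term (e i) = G.init (e (i + 1)) := by
  induction h with
  | single h =>
    obtain ⟨x, hx, rfl, rfl⟩ := h
    exact ⟨0, fun _ => x, rfl, rfl, fun _ _ => hx, fun i hi => absurd hi (by omega)⟩
  | tail _ h ih =>
    obtain ⟨x, hx, rfl, rfl⟩ := h
    obtain ⟨n, e, h0, hn, hF, hs⟩ := ih
    refine ⟨n + 1, fun k => if k ≤ n then e k else x, by simpa using h0, by simp,
      fun i hi => ?_, fun i hi => ?_⟩
    · dsimp only
      split_ifs with h
      · exact hF i h
      · exact hx
    · rcases Nat.lt_succ_iff_lt_or_eq.1 hi with h | rfl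
      · simpa [show i ≤ n by omega, show i + 1 ≤ n by omega] using hs i h
      · simpa using hn

variable [Fintype V] [DecidableEq V]

/-- In a balanced set of edges, the terminal vertex of an edge reaches its initial vertex. -/
theorem reflTransGen_of_balanced (G : DirectedGraph V E) (F : Finset E)
    (hF : ∀ u, (F.filter fun x => G.init x = u).card = (F.filter fun x => G.term x = u).card)
    {x : E} (hx : x ∈ F) : Relation.ReflTransGen (G.Step (F : Set E)) (G.term x) (G.init x) := by
  classical
  -- `R` is the set of vertices reachable from the end of `x`. Edges starting in `R` end in `R`;
  -- summing the balance over `R` shows that equally many edges start and end there, so no edge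
  -- enters `R` from outside. As `x` ends in `R`, it starts there.
  let R : Finset V := Finset.univ.filter fun u =>
    Relation.ReflTransGen (G.Step (F : Set E)) (G.term x) u
  have hR : ∀ u, u ∈ R ↔ Relation.ReflTransGen (G.Step (F : Set E)) (G.term x) u := by
    simp [R]
  have hsub : (F.filter fun y => G.init y ∈ R) ⊆ F.filter fun y => G.term y ∈ R := by
    intro y hy
    rw [Finset.mem_filter, hR] at hy ⊢
    exact ⟨hy.1, hy.2.tail ⟨y, hy.1, rfl, rfl⟩⟩
  have hcard : (F.filter fun y => G.init y ∈ R).card = (F.filter fun y => G.term y ∈ R).card := by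
    rw [Finset.card_eq_sum_card_fiberwise (s := F.filter fun y => G.init y ∈ R) (f := G.init) (t := R)
        (fun y hy => (Finset.mem_filter.1 hy).2),
      Finset.card_eq_sum_card_fiberwise (s := F.filter fun y => G.term y ∈ R) (f := G.term) (t := R)
        (fun y hy => (Finset.mem_filter.1 hy).2)]
    refine Finset.sum_congr rfl fun u hu => ?_
    rw [Finset.filter_filter, Finset.filter_filter]
    convert hF u using 3
    · constructor
      · exact fun h => h.2
      · rintro rfl; exact ⟨hu, rfl⟩
    · constructor
      · exact fun h => h.2
      · rintro rfl; exact ⟨hu, rfl⟩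
  have := Finset.eq_of_subset_of_card_le hsub hcard.ge
  have hx' : x ∈ F.filter fun y => G.init y ∈ R := by
    rw [this, Finset.mem_filter, hR]
    exact ⟨hx, .refl⟩
  exact (hR _).1 (Finset.mem_filter.1 hx').2

/-- In a balanced set of edges, every edge incident at `v` forces a directed cycle through `v`. -/
theorem exists_cycle_of_balanced (G : DirectedGraph V E) (F : Finset E)
    (hF : ∀ u, (F.filter fun x => G.init x = u).card = (F.filter fun x => G.term x = u).card)
    {v : V} {x : E} (hx : x ∈ F) (hxv : x ∈ G.incidentEdges v) :
    ∃ C : DirectedCycle G, C.Contains v ∧ C.edgeSet ⊆ F := by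
  have hr := G.reflTransGen_of_balanced F hF hx
  have hs : G.Step (F : Set E) (G.init x) (G.term x) := ⟨x, hx, rfl, rfl⟩
  have ht : Relation.TransGen (G.Step (F : Set E)) v v := by
    rcases hxv with rfl | rfl
    · exact Relation.TransGen.head' hs hr
    · exact Relation.TransGen.tail' hr hs
  obtain ⟨n, e, he⟩ := exists_walk_of_transGen ht
  exact IsClosedWalk.exists_cycle he

end DirectedGraph

/-! ### Generating polynomials of elementary symmetric functions -/

section Esymm

open Polynomial

variable {E : Type w} {K : Type*} [CommRing K]

/-- The free bound `N` lets edge sets of different sizes be expanded over the same range and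
compared termwise. -/
theorem prod_one_add_C_mul_X (φ : MvPolynomial E ℤ →+* K) (S : Finset E) {N : ℕ}
    (hN : S.card < N) :
    ∏ x ∈ S, (1 + C (φ (MvPolynomial.X x)) * X) =
      ∑ l ∈ Finset.range N, C (φ (esymmOn S l)) * X ^ l := by
  rw [Finset.prod_one_add, Finset.sum_powerset]
  rw [← Finset.sum_subset (Finset.range_subset_range.2 hN)]
  · refine Finset.sum_congr rfl fun l _ => ?_
    rw [esymmOn, map_sum, map_sum, Finset.sum_mul]
    refine Finset.sum_congr rfl fun T hT => ?_
    rw [Finset.prod_mul_distrib, Finset.prod_const, (Finset.mem_powersetCard.1 hT).2,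
      map_prod, map_prod]
  · intro l _ hl
    rw [esymmOn, Finset.powersetCard_eq_empty.2 (by simpa using hl)]
    simp

/-- A factor with `f x ≠ 0` has the single root `-(f x)⁻¹`, while `f x = 0` contributes the factor
`1`; hence only nonzero values are counted. -/
theorem count_eq_rootMultiplicity {K : Type*} [Field K] [DecidableEq K] (S : Finset E) (f : E → K)
    {t : K} (ht : t ≠ 0) :
    (S.filter fun x => f x = t).card =
      (∏ x ∈ S, (1 + C (f x) * X)).rootMultiplicity (-t⁻¹) := by
  have hne : ∀ x, (1 + C (f x) * X : K[X]) ≠ 0 := fun x h => by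
    simpa using congrArg (eval 0) h
  rw [← count_roots, roots_prod _ _ (Finset.prod_ne_zero_iff.2 fun x _ => hne x),
    Multiset.count_bind, Finset.card_filter]
  refine congrArg Multiset.sum (Multiset.map_congr rfl fun x _ => ?_)
  by_cases h0 : f x = 0
  · simp [h0, ht.symm]
  · rw [add_comm, ← C_1, roots_C_mul_X_add_C _ h0]
    simp only [mul_one, Multiset.count_singleton, neg_inj, inv_inj]
    exact if_congr eq_comm rfl rfl

end Esymm

/-! ### Points of the incidence variety -/

namespace DirectedGraph

variable {V : Type u} {E : Type w} [Fintype E] [DecidableEq V]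

/-- Outside the range of the relations both sides agree anyway: `e_0 = 1`, and `e_l = 0` for `l >
k_u`. So all coefficients of the generating polynomials match. -/
theorem map_esymmOn_eq (G : DirectedGraph V E) {K : Type*} [CommRing K]
    (φ : MvPolynomial E ℤ →+* K) (hφ : ∀ p ∈ G.incidenceIdeal, φ p = 0) (u : V) (l : ℕ) :
    φ (esymmOn (G.outEdges u) l) = φ (esymmOn (G.inEdges u) l) := by
  rcases l with _ | l
  · simp [esymmOn]
  by_cases hl : l < G.kmax u
  · have := hφ _ (Ideal.subset_span ⟨(⟨u, ⟨l, hl⟩⟩ : G.RelIndex), rfl⟩)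
    rw [incidenceRel, map_sub, sub_eq_zero] at this
    exact this
  · have h1 := le_max_left (G.outEdges u).card (G.inEdges u).card
    have h2 := le_max_right (G.outEdges u).card (G.inEdges u).card
    rw [← kmax] at h1 h2
    rw [esymmOn, esymmOn, Finset.powersetCard_eq_empty.2 (by omega),
      Finset.powersetCard_eq_empty.2 (by omega)]

/-- The level sets of a point of the incidence variety are balanced. -/
theorem balanced_of_point (G : DirectedGraph V E) {K : Type*} [Field K] [DecidableEq K]
    (φ : MvPolynomial E ℤ →+* K) (hφ : ∀ p ∈ G.incidenceIdeal, φ p = 0) {t : K} (ht : t ≠ 0)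
    (u : V) :
    ((Finset.univ.filter fun x => φ (.X x) = t).filter fun x => G.init x = u).card =
      ((Finset.univ.filter fun x => φ (.X x) = t).filter fun x => G.term x = u).card := by
  rw [Finset.filter_comm, Finset.filter_comm (p := fun x => φ (.X x) = t)]
  change ((G.outEdges u).filter _).card = ((G.inEdges u).filter _).card
  have hN := lt_add_one (G.kmax u)
  rw [count_eq_rootMultiplicity _ _ ht, count_eq_rootMultiplicity _ _ ht,
    prod_one_add_C_mul_X φ _ (lt_of_le_of_lt (le_max_left _ _) hN),
    prod_one_add_C_mul_X φ _ (lt_of_le_of_lt (le_max_right _ _) hN)]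
  simp only [G.map_esymmOn_eq φ hφ]

variable [Fintype V]

/-- If removing `S` destroys all cycles through `v`, a point of the incidence variety takes at each
edge incident at `v` the value `0` or a value taken on `S`. -/
theorem point_eq_zero_or (G : DirectedGraph V E) {K : Type*} [Field K]
    (φ : MvPolynomial E ℤ →+* K) (hφ : ∀ p ∈ G.incidenceIdeal, φ p = 0) {v : V} {S : Finset E}
    (hS : (G.deleteEdges (S : Set E)).NoCycleThrough v) {x : E} (hx : x ∈ G.incidentEdges v) :
    φ (.X x) = 0 ∨ ∃ s ∈ S, φ (.X x) = φ (.X s) := by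
  classical
  -- Otherwise the level set of the value at `x` is balanced and misses `S`, so the cycle it
  -- contains survives the deletion.
  by_contra! h
  obtain ⟨C, ⟨i, hi⟩, hC⟩ := G.exists_cycle_of_balanced _ (G.balanced_of_point φ hφ h.1)
    (x := x) (by simp) hx
  have hmem : ∀ i, C.edge i ∉ (S : Set E) := fun i hi =>
    h.2 _ hi (Finset.mem_filter.1 (hC ⟨i, rfl⟩)).2.symm
  exact hS ⟨⟨C.n, C.vertex, fun i => ⟨C.edge i, hmem i⟩, C.vertex_injective, C.init_edge,
    C.term_edge⟩, i, hi⟩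

/-- The radical is the intersection of the primes `P ⊇ I(G)`, and each `P` is the kernel of a point
with values in the fraction field of the quotient by `P`. -/
theorem mul_prod_sub_mem_radical (G : DirectedGraph V E) {v : V} {S : Finset E}
    (hS : (G.deleteEdges (S : Set E)).NoCycleThrough v) {x : E} (hx : x ∈ G.incidentEdges v) :
    (.X x * ∏ s ∈ S, (.X x - .X s) : MvPolynomial E ℤ) ∈ G.incidenceIdeal.radical := by
  rw [Ideal.radical_eq_sInf, Submodule.mem_sInf]
  rintro P ⟨hIP, hP⟩
  let φ := (algebraMap (MvPolynomial E ℤ ⧸ P) (FractionRing (MvPolynomial E ℤ ⧸ P))).comp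
    (Ideal.Quotient.mk P)
  have hφ : ∀ p, φ p = 0 ↔ p ∈ P := fun p => by
    simp [φ, Ideal.Quotient.eq_zero_iff_mem]
  rw [← hφ, map_mul, map_prod, mul_eq_zero, Finset.prod_eq_zero_iff]
  simpa [sub_eq_zero] using G.point_eq_zero_or φ (fun p hp => (hφ p).2 (hIP hp)) hS hx

end DirectedGraph

/-! ### Annihilators of Koszul homology, before and after scalar extension -/

section Homology

universe v
variable {R : Type w} [CommRing R]

/-- A scalar annihilates the degree zero homology iff it maps chains to boundaries. -/
theorem mem_annihilator_homology_zero (K : ChainComplex (ModuleCat.{v} R) ℕ) (f : R) :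
    f ∈ Module.annihilator R (K.homology 0) ↔ ∀ x : K.X 0, ∃ y : K.X 1, K.d 1 0 y = f • x := by
  rw [K.isoHomologyι₀.toLinearEquiv.annihilator_eq, Module.mem_annihilator]
  have hex : (ShortComplex.mk (K.d 1 0) (K.pOpcycles 0) (K.d_pOpcycles 1 0)).Exact :=
    ShortComplex.exact_of_g_is_cokernel _ (K.opcyclesIsCokernel 1 0 (by simp))
  rw [ShortComplex.moduleCat_exact_iff] at hex
  constructor
  · intro h x
    exact hex (f • x) (by simpa using h (K.pOpcycles 0 x))
  · intro h m
    obtain ⟨x, rfl⟩ := (ModuleCat.epi_iff_surjective (K.pOpcycles 0)).1 inferInstance m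
    obtain ⟨y, hy⟩ := h x
    rw [← map_smul, ← hy, ← ModuleCat.comp_apply, K.d_pOpcycles]
    rfl

/-- A scalar mapping cycles to boundaries annihilates the homology. -/
theorem mem_annihilator_homology (K : ChainComplex (ModuleCat.{v} R) ℕ) (n : ℕ) (f : R)
    (h : ∀ x : K.X n, (∀ m, K.d n m x = 0) → ∃ y : K.X (n + 1), K.d (n + 1) n y = f • x) :
    f ∈ Module.annihilator R (K.homology n) := by
  rw [Module.mem_annihilator]
  intro m
  obtain ⟨c, rfl⟩ := (ModuleCat.epi_iff_surjective (K.homologyπ n)).1 inferInstance m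
  obtain ⟨y, hy⟩ := h (K.iCycles n c) fun m => by
    rw [← ModuleCat.comp_apply, K.iCycles_d]; rfl
  have hc : K.toCycles (n + 1) n y = f • c := by
    apply (ModuleCat.mono_iff_injective (K.iCycles n)).1 inferInstance
    rw [← ModuleCat.comp_apply, K.toCycles_i, hy, map_smul]
  rw [← map_smul, ← hc, ← ModuleCat.comp_apply, K.toCycles_comp_homologyπ]
  rfl

variable {ι : Type u}

/-- Exterior multiplication by a basis vector. -/
noncomputable def wedgeSingle (R : Type w) [CommRing R] (i : ι) (n : ℕ) (z : ⋀[R]^n (ι →₀ R)) :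
    ⋀[R]^(n + 1) (ι →₀ R) :=
  ⟨ExteriorAlgebra.ι R (Finsupp.single i (1 : R)) * (z : ExteriorAlgebra R (ι →₀ R)), by
    have hz := z.2
    unfold ExteriorAlgebra.exteriorPower at hz ⊢
    rw [pow_succ']
    exact Submodule.mul_mem_mul ⟨_, rfl⟩ hz⟩

/-- Contraction is an antiderivation, so wedging with `e_i` is a homotopy from multiplication by `r
i` to zero. -/
theorem koszulD_wedgeSingle_succ (r : ι → R) (i : ι) (n : ℕ) (z : ⋀[R]^(n + 1) (ι →₀ R)) :
    koszulD r (n + 1) (wedgeSingle R i (n + 1) z) = r i • z - wedgeSingle R i n (koszulD r n z) := by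
  refine Subtype.ext ?_
  change CliffordAlgebra.contractLeft (Q := (0 : QuadraticForm R (ι →₀ R))) _
    (CliffordAlgebra.ι _ _ * (z : ExteriorAlgebra R (ι →₀ R))) = _
  rw [CliffordAlgebra.contractLeft_ι_mul]
  simp [wedgeSingle, koszulD, ExteriorAlgebra.ι]

theorem koszulD_wedgeSingle_zero (r : ι → R) (i : ι) (z : ⋀[R]^0 (ι →₀ R)) :
    koszulD r 0 (wedgeSingle R i 0 z) = r i • z := by
  refine Subtype.ext ?_
  change CliffordAlgebra.contractLeft (Q := (0 : QuadraticForm R (ι →₀ R))) _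
    (CliffordAlgebra.ι _ _ * (z : ExteriorAlgebra R (ι →₀ R))) = _
  rw [CliffordAlgebra.contractLeft_ι_mul]
  obtain ⟨a, ha⟩ := Submodule.mem_one.1
    ((pow_zero (LinearMap.range (ExteriorAlgebra.ι R (M := ι →₀ R)))).le z.2)
  have : CliffordAlgebra.contractLeft (Q := (0 : QuadraticForm R (ι →₀ R)))
      (Finsupp.linearCombination R r) (z : ExteriorAlgebra R (ι →₀ R)) = 0 := by
    rw [← ha]
    exact CliffordAlgebra.contractLeft_algebraMap _ _ _
  simp [this]

theorem koszulComplex_d (r : ι → R) (n : ℕ) :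
    (koszulComplex r).d (n + 1) n = ModuleCat.ofHom (koszulD r n) :=
  ChainComplex.of_d (fun n => ModuleCat.of R (⋀[R]^n (ι →₀ R)))
    (fun n => ModuleCat.ofHom (koszulD r n)) n

/-- The ideal of the family annihilates the Koszul homology. -/
theorem span_le_annihilator_koszul (r : ι → R) (n : ℕ) :
    Ideal.span (Set.range r) ≤ Module.annihilator R ((koszulComplex r).homology n) := by
  rw [Ideal.span_le]
  rintro _ ⟨i, rfl⟩
  refine mem_annihilator_homology _ _ _ fun x hx => ⟨wedgeSingle R i n x, ?_⟩
  rw [koszulComplex_d]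
  rcases n with _ | n
  · exact koszulD_wedgeSingle_zero r i x
  · have h := hx n
    rw [koszulComplex_d] at h
    refine (koszulD_wedgeSingle_succ r i n x).trans ?_
    rw [show koszulD r n x = 0 from h]
    refine (congrArg _ ?_).trans (sub_zero _)
    exact Subtype.ext (mul_zero (ExteriorAlgebra.ι R (Finsupp.single i (1 : R))))

/-- The identification of the zeroth exterior power with the base ring. -/
noncomputable def exteriorZero (R : Type w) [CommRing R] (ι : Type u) :
    ⋀[R]^0 (ι →₀ R) →ₗ[R] R :=
  ExteriorAlgebra.algebraMapInv.toLinearMap ∘ₗ Submodule.subtype _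

theorem exteriorZero_koszulD_mem (r : ι → R) (z : ⋀[R]^1 (ι →₀ R)) :
    exteriorZero R ι (koszulD r 0 z) ∈ Ideal.span (Set.range r) := by
  obtain ⟨m, hm⟩ := (pow_one (LinearMap.range (ExteriorAlgebra.ι R (M := ι →₀ R)))).le z.2
  have : exteriorZero R ι (koszulD r 0 z) = Finsupp.linearCombination R r m := by
    change ExteriorAlgebra.algebraMapInv (CliffordAlgebra.contractLeft _
      (z : ExteriorAlgebra R (ι →₀ R))) = _
    rw [← hm]
    change ExteriorAlgebra.algebraMapInv (CliffordAlgebra.contractLeft _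
      (CliffordAlgebra.ι _ m)) = _
    rw [CliffordAlgebra.contractLeft_ι]
    exact ExteriorAlgebra.algebraMap_leftInverse _ _
  rw [this, Finsupp.linearCombination_apply]
  exact Ideal.sum_mem _ fun i _ => Ideal.mul_mem_left _ _ (Ideal.subset_span ⟨i, rfl⟩)

/-- The unit of the exterior algebra in degree zero. -/
noncomputable def exteriorOne (R : Type w) [CommRing R] (ι : Type u) : ⋀[R]^0 (ι →₀ R) :=
  ⟨1, by unfold ExteriorAlgebra.exteriorPower; rw [pow_zero]; exact Submodule.one_le.1 le_rfl⟩

theorem exteriorZero_one : exteriorZero R ι (exteriorOne R ι) = 1 :=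
  map_one ExteriorAlgebra.algebraMapInv

/-- If `f` kills the class of `1`, then `f` is a boundary, and boundaries in degree zero lie in the
ideal of the family. -/
theorem annihilator_koszul_zero (r : ι → R) :
    Module.annihilator R ((koszulComplex r).homology 0) = Ideal.span (Set.range r) := by
  refine le_antisymm (fun f hf => ?_) (span_le_annihilator_koszul r 0)
  obtain ⟨y, hy⟩ := (mem_annihilator_homology_zero _ _).1 hf (exteriorOne R ι)
  rw [koszulComplex_d] at hy
  have h := exteriorZero_koszulD_mem r y
  rw [show koszulD r 0 y = f • exteriorOne R ι from hy, map_smul, exteriorZero_one] at h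
  simpa using h

variable {S : Type w} [CommRing S]

open scoped ChangeOfRings

theorem extendScalars_induction (φ : R →+* S) {N : ModuleCat.{max u w} R}
    {motive : (ModuleCat.extendScalars.{w, w, max u w} φ).obj N → Prop} (zero : motive 0)
    (tmul : ∀ (s : S) (x : N), motive (s ⊗ₜ[R,φ] x)) (add : ∀ a b, motive a → motive b → motive (a + b))
    (z : (ModuleCat.extendScalars.{w, w, max u w} φ).obj N) : motive z :=
  TensorProduct.induction_on (motive := motive) z zero tmul add

theorem exists_extendScalars_map_eq (φ : R →+* S) {M N : ModuleCat.{max u w} R} (g : M ⟶ N) (f : R)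
    (h : ∀ x : N, ∃ y : M, g y = f • x)
    (z : (ModuleCat.extendScalars.{w, w, max u w} φ).obj N) :
    ∃ y, (ModuleCat.extendScalars.{w, w, max u w} φ).map g y = φ f • z := by
  induction z using extendScalars_induction with
  | zero => exact ⟨0, by rw [map_zero, smul_zero]⟩
  | tmul s x =>
    obtain ⟨y, hy⟩ := h x
    refine ⟨s ⊗ₜ[R,φ] y, ?_⟩
    rw [ModuleCat.ExtendScalars.map_tmul, hy]
    let _ : Module R S := Module.compHom S φ
    exact (TensorProduct.smul_tmul f s x).symm.trans
      (ModuleCat.ExtendScalars.smul_tmul φ (φ f) s x).symm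
  | add a b ha hb =>
    obtain ⟨a', ha⟩ := ha
    obtain ⟨b', hb⟩ := hb
    exact ⟨a' + b', by rw [map_add, ha, hb, smul_add]⟩

/-- The map `S ⊗ N → S ⧸ I S` induced by a linear form on `N`. -/
noncomputable def extendForm (φ : R →+* S) (I : Ideal R) {N : ModuleCat.{max u w} R}
    (ε : N →ₗ[R] R) : (ModuleCat.extendScalars.{w, w, max u w} φ).obj N →+ S ⧸ I.map φ :=
  letI : Module R S := Module.compHom S φ
  letI : Module R (S ⧸ I.map φ) := Module.compHom _ φ
  (TensorProduct.lift (LinearMap.mk₂ R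
    (fun (s : S) (x : N) => Ideal.Quotient.mk (I.map φ) (s * φ (ε x)))
    (fun s t x => by rw [add_mul, map_add])
    (fun c s x => by
      change Ideal.Quotient.mk (I.map φ) (φ c * s * _) = φ c • Ideal.Quotient.mk (I.map φ) _
      rw [mul_assoc]; rfl)
    (fun s x y => by rw [map_add, map_add, mul_add, map_add])
    (fun c s x => by
      change _ = Ideal.Quotient.mk (I.map φ) (φ c * (s * φ (ε x)))
      rw [map_smul, smul_eq_mul, map_mul φ, mul_left_comm]))).toAddMonoidHom

/-- `extendForm` vanishes on the image of the extended map and sends `f • (1 ⊗ x)` to the class of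
`f`. -/
theorem mem_map_of_extendScalars_map_eq (φ : R →+* S) (I : Ideal R) {M N : ModuleCat.{max u w} R}
    (g : M ⟶ N) (ε : N →ₗ[R] R) (hε : ∀ y : M, ε (g y) ∈ I) {x : N} (hx : ε x = 1) {f : S}
    {z : (ModuleCat.extendScalars.{w, w, max u w} φ).obj M}
    (hz : (ModuleCat.extendScalars.{w, w, max u w} φ).map g z =
      f • (show (ModuleCat.extendScalars.{w, w, max u w} φ).obj N from (1 : S) ⊗ₜ[R,φ] x)) :
    f ∈ I.map φ := by
  have hd : extendForm φ I ε ((ModuleCat.extendScalars.{w, w, max u w} φ).map g z) = 0 := by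
    clear hz
    induction z using extendScalars_induction with
    | zero => rw [map_zero, map_zero]
    | tmul s y =>
      exact Ideal.Quotient.eq_zero_iff_mem.2 (Ideal.mul_mem_left _ s (Ideal.mem_map_of_mem φ (hε y)))
    | add a b ha hb => rw [map_add, map_add, ha, hb, add_zero]
  have h : Ideal.Quotient.mk (I.map φ) (f * 1 * φ (ε x)) = 0 := (congrArg _ hz).symm.trans hd
  rwa [hx, map_one, mul_one, mul_one, Ideal.Quotient.eq_zero_iff_mem] at h

/-- The degree zero homology of the scalar extension of a Koszul complex. -/
theorem annihilator_koszul_extendScalars_zero (φ : R →+* S) (r : ι → R) :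
    Module.annihilator S
      ((((ModuleCat.extendScalars.{w, w, max u w} φ).mapHomologicalComplex
        (ComplexShape.down ℕ)).obj (koszulComplex r)).homology 0) =
      (Ideal.span (Set.range r)).map φ := by
  refine le_antisymm (fun f hf => ?_) ?_
  · obtain ⟨z, hz⟩ := (mem_annihilator_homology_zero _ _).1 hf ((1 : S) ⊗ₜ[R,φ] exteriorOne R ι)
    refine mem_map_of_extendScalars_map_eq φ _ ((koszulComplex r).d 1 0) (exteriorZero R ι)
      (fun y => ?_) exteriorZero_one hz
    rw [koszulComplex_d]
    exact exteriorZero_koszulD_mem r y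
  · rw [Ideal.map_le_iff_le_comap]
    intro f hf
    rw [Ideal.mem_comap, mem_annihilator_homology_zero]
    exact exists_extendScalars_map_eq φ _ f
      ((mem_annihilator_homology_zero _ _).1 (span_le_annihilator_koszul r 0 hf))

end Homology

/-! ### Krull dimension: integrality, and passage from `ℚ` to `ℤ` -/

section Dimension

theorem krullDim_add_one_le {α β : Type*} [Preorder α] [Preorder β] (f : α → β)
    (hf : StrictMono f) (h : ∀ a, ∃ b, f a < b) :
    Order.krullDim α + 1 ≤ Order.krullDim β := by
  cases isEmpty_or_nonempty α
  · simp [Order.krullDim_eq_bot]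
  have : Nonempty β := Nonempty.map f inferInstance
  rw [Order.krullDim_eq_iSup_length, Order.krullDim_eq_iSup_length, ← WithBot.coe_one,
    ← WithBot.coe_add, ENat.iSup_add, WithBot.coe_le_coe, iSup_le_iff]
  intro l
  obtain ⟨b, hb⟩ := h l.last
  refine le_trans ?_ (le_iSup _ ((l.map f hf).snoc b hb))
  simp [RelSeries.snoc, RelSeries.append, LTSeries.map]

/-- Incomparability alone gives this inequality; the structure map need not be injective. -/
theorem ringKrullDim_le_of_isIntegral (A B : Type*) [CommRing A] [CommRing B] [Algebra A B]
    [Algebra.IsIntegral A B] : ringKrullDim B ≤ ringKrullDim A :=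
  Order.krullDim_le_of_strictMono (PrimeSpectrum.comap (algebraMap A B)) fun p q h =>
    Ideal.IsIntegral.comap_lt_comap (I := p.asIdeal) (J := q.asIdeal) h

theorem isJacobsonRing_int : IsJacobsonRing ℤ := by
  rw [isJacobsonRing_iff_prime_eq]
  intro P hP
  by_cases h : P = ⊥
  · subst h
    refine le_antisymm (fun x hx => ?_) Ideal.le_jacobson
    -- The unit obtained is `3x² + 1`; being positive it equals `1`, so `x = 0`.
    have := Int.isUnit_iff.1 (Ideal.mem_jacobson_bot.1 hx (3 * x))
    have hx : x = 0 := by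
      rcases this with h | h
      · nlinarith [sq_nonneg x]
      · nlinarith [sq_nonneg x]
    simp [hx]
  · exact Ideal.jacobson_eq_self_of_isMaximal (H := hP.isMaximal h)

/-- A field of finite type over the Jacobson ring `ℤ` is finite over it. If `ℤ` also embeds,
integrality would make `ℤ` a field. -/
theorem not_isMaximal_of_comap_int_eq_bot {B : Type*} [CommRing B]
    (hB : (Int.castRingHom B).FiniteType)
    (P : Ideal B) (h : ∀ n : ℤ, (n : B) ∈ P → n = 0) : ¬ P.IsMaximal := by
  intro hP
  let _ := Ideal.Quotient.field P
  have := isJacobsonRing_int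
  let f : ℤ →+* B ⧸ P := (Ideal.Quotient.mk P).comp (Int.castRingHom B)
  have hf : f.Finite := RingHom.finite_iff_finiteType_of_isJacobsonRing.2
    (hB.comp_surjective Ideal.Quotient.mk_surjective)
  let _ : Algebra ℤ (B ⧸ P) := f.toAlgebra
  have : Algebra.IsIntegral ℤ (B ⧸ P) := ⟨hf.to_isIntegral⟩
  refine Int.not_isField (isField_of_isIntegral_of_isField (S := B ⧸ P)
    ((injective_iff_map_eq_zero f).2 fun n hn => h n ?_) (Field.toIsField _))
  exact Ideal.Quotient.eq_zero_iff_mem.1 hn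

variable {σ : Type*}

/-- Every rational polynomial has a non-zero integral multiple with integral coefficients. -/
theorem exists_int_mul_eq_map (p : MvPolynomial σ ℚ) :
    ∃ (n : ℤ) (q : MvPolynomial σ ℤ), n ≠ 0 ∧
      MvPolynomial.map (Int.castRingHom ℚ) q = (n : MvPolynomial σ ℚ) * p := by
  induction p using MvPolynomial.induction_on with
  | C a =>
    refine ⟨a.den, MvPolynomial.C a.num, by simp, ?_⟩
    have : (Int.castRingHom ℚ) a.num = (a.den : ℚ) * a := by simp
    rw [MvPolynomial.map_C, this, map_mul]
    simp
  | add p q hp hq =>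
    obtain ⟨n, p', hn, hp⟩ := hp
    obtain ⟨m, q', hm, hq⟩ := hq
    refine ⟨n * m, MvPolynomial.C m * p' + MvPolynomial.C n * q', mul_ne_zero hn hm, ?_⟩
    rw [map_add, map_mul, map_mul, hp, hq]
    simp
    ring
  | mul_X p i hp =>
    obtain ⟨n, p', hn, hp⟩ := hp
    refine ⟨n, p' * MvPolynomial.X i, hn, ?_⟩
    rw [map_mul, hp, MvPolynomial.map_X, mul_assoc]

/-- Clearing denominators shows that a prime is determined by its contraction, since nonzero
integers are units on the rational side. For the same reason the contraction meets `ℤ` in `0`, so it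
lies strictly below a maximal ideal. -/
theorem ringKrullDim_rat_add_one_le [Finite σ] (J : Ideal (MvPolynomial σ ℤ))
    (J' : Ideal (MvPolynomial σ ℚ))
    (h : J ≤ J'.comap (MvPolynomial.map (Int.castRingHom ℚ))) :
    ringKrullDim (MvPolynomial σ ℚ ⧸ J') + 1 ≤ ringKrullDim (MvPolynomial σ ℤ ⧸ J) := by
  let g : MvPolynomial σ ℤ ⧸ J →+* MvPolynomial σ ℚ ⧸ J' := Ideal.quotientMap J' _ h
  have hunit : ∀ (P : Ideal (MvPolynomial σ ℚ ⧸ J')), P ≠ ⊤ → ∀ n : ℤ,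
      (n : MvPolynomial σ ℚ ⧸ J') ∈ P → n = 0 := by
    intro P hP n hn
    by_contra h0
    refine hP (Ideal.eq_top_of_isUnit_mem _ hn ?_)
    have : IsUnit (algebraMap ℚ (MvPolynomial σ ℚ ⧸ J') (n : ℚ)) :=
      (IsUnit.mk0 (n : ℚ) (by exact_mod_cast h0)).map _
    simpa using this
  refine krullDim_add_one_le (PrimeSpectrum.comap g) ?_ ?_
  · refine Monotone.strictMono_of_injective (fun p q h => Ideal.comap_mono h) ?_
    have key : ∀ p q : PrimeSpectrum (MvPolynomial σ ℚ ⧸ J'),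
        PrimeSpectrum.comap g p = PrimeSpectrum.comap g q → p.asIdeal ≤ q.asIdeal := by
      intro p q hpq y hy
      obtain ⟨y, rfl⟩ := Ideal.Quotient.mk_surjective y
      obtain ⟨n, z, hn, hz⟩ := exists_int_mul_eq_map y
      have hg : g (Ideal.Quotient.mk J z) = (n : MvPolynomial σ ℚ ⧸ J') * Ideal.Quotient.mk J' y := by
        rw [Ideal.quotientMap_mk, hz, map_mul, map_intCast]
      have h1 : Ideal.Quotient.mk J z ∈ (PrimeSpectrum.comap g p).asIdeal := by
        change g _ ∈ p.asIdeal
        rw [hg]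
        exact Ideal.mul_mem_left _ _ hy
      rw [hpq] at h1
      change g _ ∈ q.asIdeal at h1
      rw [hg] at h1
      exact (q.isPrime.mem_or_mem h1).resolve_left fun h => hn (hunit _ q.isPrime.ne_top n h)
    exact fun p q hpq => PrimeSpectrum.ext (le_antisymm (key p q hpq) (key q p hpq.symm))
  · intro p
    have hfin : (Int.castRingHom (MvPolynomial σ ℤ ⧸ J)).FiniteType := by
      have h1 : (algebraMap ℤ (MvPolynomial σ ℤ)).FiniteType :=
        RingHom.finiteType_algebraMap.2 inferInstance
      convert h1.comp_surjective (g := Ideal.Quotient.mk J) Ideal.Quotient.mk_surjective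
      exact Subsingleton.elim _ _
    have hnm := not_isMaximal_of_comap_int_eq_bot hfin (PrimeSpectrum.comap g p).asIdeal fun n hn => by
      refine hunit _ p.isPrime.ne_top n ?_
      rw [← map_intCast g]
      exact hn
    obtain ⟨M, hM, hle⟩ := Ideal.exists_le_maximal _ (PrimeSpectrum.comap g p).isPrime.ne_top
    refine ⟨⟨M, hM.isPrime⟩, lt_of_le_of_ne hle fun h => hnm ?_⟩
    rw [h]
    exact hM

/-- A ring map to a quotient of a polynomial ring over `ℤ` is integral once the classes of the
variables are integral. -/
theorem isIntegral_of_X {A : Type*} [CommRing A] (J : Ideal (MvPolynomial σ ℤ))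
    [Algebra A (MvPolynomial σ ℤ ⧸ J)]
    (h : ∀ i, IsIntegral A (Ideal.Quotient.mk J (MvPolynomial.X i))) :
    Algebra.IsIntegral A (MvPolynomial σ ℤ ⧸ J) := by
  refine ⟨fun b => ?_⟩
  obtain ⟨p, rfl⟩ := Ideal.Quotient.mk_surjective b
  induction p using MvPolynomial.induction_on with
  | C a =>
    have : Ideal.Quotient.mk J (MvPolynomial.C a) =
        algebraMap A (MvPolynomial σ ℤ ⧸ J) (a : A) := by simp
    rw [this]
    exact isIntegral_algebraMap
  | add p q hp hq =>
    rw [map_add]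
    exact hp.add hq
  | mul_X p i hp =>
    rw [map_mul]
    exact hp.mul (h i)

theorem finite_of_X_pow_mem [Finite σ] (J : Ideal (MvPolynomial σ ℤ)) {n : ℕ} (hn : 1 ≤ n)
    (h : ∀ i, MvPolynomial.X i ^ n ∈ J) : Module.Finite ℤ (MvPolynomial σ ℤ ⧸ J) := by
  have : Algebra.IsIntegral ℤ (MvPolynomial σ ℤ ⧸ J) := isIntegral_of_X J fun i => by
    refine IsIntegral.of_pow hn ?_
    rw [← map_pow, Ideal.Quotient.eq_zero_iff_mem.2 (h i)]
    exact isIntegral_zero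
  have : Algebra.FiniteType ℤ (MvPolynomial σ ℤ ⧸ J) :=
    .of_surjective (Ideal.Quotient.mkₐ ℤ J) Ideal.Quotient.mk_surjective
  exact Algebra.IsIntegral.finite

theorem ringKrullDim_int : ringKrullDim ℤ = 1 :=
  IsPrincipalIdealRing.ringKrullDim_eq_one ℤ Int.not_isField

theorem ringKrullDim_le_card_add_one (J : Ideal (MvPolynomial σ ℤ)) (S : Finset σ)
    (h : ∀ x, (.X x * ∏ s ∈ S, (.X x - .X s) : MvPolynomial σ ℤ) ∈ J.radical) :
    ringKrullDim (MvPolynomial σ ℤ ⧸ J) ≤ (S.card : WithBot ℕ∞) + 1 := by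
  let g : MvPolynomial S ℤ →+* MvPolynomial σ ℤ ⧸ J :=
    (Ideal.Quotient.mk J).comp (MvPolynomial.rename (Subtype.val : S → σ)).toRingHom
  let _ := g.toAlgebra
  have hX : ∀ s : S, algebraMap (MvPolynomial S ℤ) (MvPolynomial σ ℤ ⧸ J) (MvPolynomial.X s) =
      Ideal.Quotient.mk J (MvPolynomial.X s) := fun s => by
    change Ideal.Quotient.mk J (MvPolynomial.rename _ _) = _
    rw [MvPolynomial.rename_X]
  have : Algebra.IsIntegral (MvPolynomial S ℤ) (MvPolynomial σ ℤ ⧸ J) := by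
    refine isIntegral_of_X J fun i => ?_
    obtain ⟨n, hn⟩ := h i
    -- A power of the hypothesis, read as a monic equation for the variable over `ℤ[S]`.
    refine ⟨(Polynomial.X * ∏ s : S, (Polynomial.X - Polynomial.C (MvPolynomial.X s))) ^ n,
      (Polynomial.monic_X.mul (Polynomial.monic_prod_of_monic _ _ fun s _ =>
        Polynomial.monic_X_sub_C _)).pow n, ?_⟩
    rw [← Ideal.Quotient.eq_zero_iff_mem] at hn
    rw [← hn, ← Finset.prod_coe_sort S]
    simp [Polynomial.eval₂_finsetProd, hX]
  refine (ringKrullDim_le_of_isIntegral (MvPolynomial S ℤ) _).trans ?_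
  rw [MvPolynomial.ringKrullDim_of_isNoetherianRing, ringKrullDim_int, add_comm]
  simp

end Dimension

/-! ### The point defined by edge-disjoint cycles -/

namespace DirectedGraph

variable {V : Type u} {E : Type w} [Fintype E] [DecidableEq V]

-- Edges of the cycle leaving `u` are indexed by `vertex i = u`, those entering by `vertex (i + 1) =
-- u`; cyclic rotation of the indices matches them.
omit [Fintype E] in
theorem cycle_card_init {G : DirectedGraph V E} (C : DirectedCycle G) (A B : Finset E) (u : V)
    [DecidablePred (· ∈ C.edgeSet)]
    (hA : ∀ x, x ∈ A ↔ G.init x = u) (hB : ∀ x, x ∈ B ↔ G.term x = u) :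
    (A.filter (· ∈ C.edgeSet)).card = (B.filter (· ∈ C.edgeSet)).card := by
  classical
  have hinj : Function.Injective C.edge := fun i j h =>
    C.vertex_injective (by rw [← C.init_edge, ← C.init_edge, h])
  have h1 : A.filter (· ∈ C.edgeSet) =
      (Finset.univ.filter fun i => C.vertex i = u).image C.edge := by
    ext x
    simp only [Finset.mem_filter, hA, Finset.mem_image, Finset.mem_univ, true_and,
      DirectedCycle.edgeSet, Set.mem_range]
    constructor
    · rintro ⟨h, i, rfl⟩
      exact ⟨i, by rw [← C.init_edge, h], rfl⟩
    · rintro ⟨i, h, rfl⟩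
      exact ⟨by rw [C.init_edge, h], i, rfl⟩
  have h2 : B.filter (· ∈ C.edgeSet) =
      (Finset.univ.filter fun i => C.vertex (i + 1) = u).image C.edge := by
    ext x
    simp only [Finset.mem_filter, hB, Finset.mem_image, Finset.mem_univ, true_and,
      DirectedCycle.edgeSet, Set.mem_range]
    constructor
    · rintro ⟨h, i, rfl⟩
      exact ⟨i, by rw [← C.term_edge, h], rfl⟩
    · rintro ⟨i, h, rfl⟩
      exact ⟨by rw [C.term_edge, h], i, rfl⟩
  rw [h1, h2, Finset.card_image_of_injective _ hinj, Finset.card_image_of_injective _ hinj]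
  exact (Finset.card_equiv (Equiv.addRight 1) (by simp)).symm

open Classical in
/-- The point of the incidence variety taking the value `X i` on the `i`-th of a family of cycles,
and `0` on all other edges. -/
noncomputable def cycleValue {G : DirectedGraph V E} {k : ℕ} (C : Fin k → DirectedCycle G) (x : E) :
    MvPolynomial (Fin k) ℚ :=
  ∑ i, if x ∈ (C i).edgeSet then MvPolynomial.X i else 0

omit [Fintype E] [DecidableEq V] in
theorem cycleValue_of_mem {G : DirectedGraph V E} {k : ℕ} {C : Fin k → DirectedCycle G}
    (hC : Pairwise fun i j => Disjoint (C i).edgeSet (C j).edgeSet) {x : E} {i : Fin k}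
    (hx : x ∈ (C i).edgeSet) : cycleValue C x = MvPolynomial.X i := by
  rw [cycleValue, Finset.sum_eq_single i, if_pos hx]
  · exact fun j _ hj => if_neg fun h => Set.disjoint_left.1 (hC hj) h hx
  · simp

-- The generating polynomial of an edge set `A` becomes `∏ (1 + X_i T) ^ |A ∩ C_i|`, and each cycle
-- leaves a vertex as often as it enters it.
open Polynomial in
theorem cycleValue_kills (G : DirectedGraph V E) {k : ℕ} (C : Fin k → DirectedCycle G)
    (hC : Pairwise fun i j => Disjoint (C i).edgeSet (C j).edgeSet)
    (φ : MvPolynomial E ℤ →+* MvPolynomial (Fin k) ℚ)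
    (hφ : ∀ x, φ (MvPolynomial.X x) = cycleValue C x) :
    ∀ p ∈ G.incidenceIdeal, φ p = 0 := by
  classical
  have hprod : ∀ A : Finset E, ∏ x ∈ A, (1 + Polynomial.C (φ (MvPolynomial.X x)) * X) =
      ∏ i, (1 + Polynomial.C (MvPolynomial.X i) * X : (MvPolynomial (Fin k) ℚ)[X]) ^
        (A.filter (· ∈ (C i).edgeSet)).card := by
    intro A
    have : ∀ x, (1 + Polynomial.C (φ (MvPolynomial.X x)) * X : (MvPolynomial (Fin k) ℚ)[X]) =
        ∏ i, if x ∈ (C i).edgeSet then (1 + Polynomial.C (MvPolynomial.X i) * X) else 1 := by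
      intro x
      rw [hφ]
      by_cases h : ∃ i, x ∈ (C i).edgeSet
      · obtain ⟨i, hi⟩ := h
        rw [cycleValue_of_mem hC hi, Finset.prod_eq_single i, if_pos hi]
        · exact fun j _ hj => if_neg fun h => Set.disjoint_left.1 (hC hj) h hi
        · simp
      · push Not at h
        simp [cycleValue, h]
    simp_rw [this]
    rw [Finset.prod_comm]
    refine Finset.prod_congr rfl fun i _ => ?_
    rw [Finset.prod_ite, Finset.prod_const_one, mul_one, Finset.prod_const]
  suffices h : Ideal.span (Set.range G.incidenceRel) ≤ RingHom.ker φ from fun p hp => h hp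
  rw [Ideal.span_le]
  rintro _ ⟨⟨u, l⟩, rfl⟩
  change φ _ = 0
  rw [incidenceRel, map_sub, sub_eq_zero]
  have hN := lt_add_one (G.kmax u)
  have heq : ∏ x ∈ G.outEdges u, (1 + Polynomial.C (φ (MvPolynomial.X x)) * X) =
      ∏ x ∈ G.inEdges u, (1 + Polynomial.C (φ (MvPolynomial.X x)) * X) := by
    rw [hprod, hprod]
    refine Finset.prod_congr rfl fun i _ => ?_
    rw [cycle_card_init (C i) (G.outEdges u) (G.inEdges u) u (fun x => by simp [outEdges])
      (fun x => by simp [inEdges])]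
  rw [prod_one_add_C_mul_X φ _ (lt_of_le_of_lt (le_max_left _ _) hN),
    prod_one_add_C_mul_X φ _ (lt_of_le_of_lt (le_max_right _ _) hN)] at heq
  have := congrArg (fun p => p.coeff (l + 1)) heq
  simpa [Polynomial.finsetSum_coeff, Polynomial.coeff_X_pow] using this

end DirectedGraph

/-! ### The dimension bounds and the equivalences -/

theorem le_of_add_one_le_one {a : WithBot ℕ∞} (h : a + 1 ≤ 1) : a ≤ 0 := by
  induction a with
  | bot => exact bot_le
  | coe a =>
    have h' : a + 1 ≤ 0 + 1 := by
      rw [zero_add]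
      exact_mod_cast h
    exact_mod_cast (ENat.add_le_add_iff_right ENat.one_ne_top).1 h'

theorem polyIncl_X {E : Type w} (k : Type) [CommRing k] {F : Set E} (x : F) :
    polyIncl k F (MvPolynomial.X x) = MvPolynomial.X (x : E) :=
  MvPolynomial.rename_X _ _

namespace DirectedGraph

variable {V : Type u} {E : Type w} [Fintype E] [DecidableEq V]

theorem annZero_eq (G : DirectedGraph V E) (v : V) :
    G.annZero v = G.incidenceIdeal.comap (polyIncl ℤ (G.incidentEdges v)) :=
  congrArg (Ideal.comap _) (annihilator_koszul_zero G.incidenceRel)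

theorem annVia_rat_eq (G : DirectedGraph V E) (v : V) :
    annVia (polyIncl ℚ (G.incidentEdges v)) (G.krHomologyRat 0) =
      (G.incidenceIdeal.map (MvPolynomial.map (Int.castRingHom ℚ))).comap
        (polyIncl ℚ (G.incidentEdges v)) :=
  congrArg (Ideal.comap _) (annihilator_koszul_extendScalars_zero _ G.incidenceRel)

theorem annTotal_le_annZero (G : DirectedGraph V E) (v : V) : G.annTotal v ≤ G.annZero v := by
  intro s hs
  rw [annTotal, mem_annVia] at hs
  rw [annZero, mem_annVia]
  intro m
  have h := hs (DirectSum.lof (MvPolynomial E ℤ) ℕ (fun n => G.krHomology n) 0 m)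
  rw [← map_smul] at h
  exact (DirectSum.of_injective (β := fun n => G.krHomology n) 0) (h.trans (map_zero _).symm)

theorem comap_incidenceIdeal_le_annTotal (G : DirectedGraph V E) (v : V) :
    G.incidenceIdeal.comap (polyIncl ℤ (G.incidentEdges v)) ≤ G.annTotal v := by
  refine Ideal.comap_mono fun f hf => ?_
  rw [Module.mem_annihilator]
  intro m
  refine DFinsupp.ext fun n => ?_
  exact Module.mem_annihilator.1 (span_le_annihilator_koszul G.incidenceRel n hf) (m n)

/-- The number of edge-disjoint cycles through `v` bounds the rational Krull dimension below. -/
theorem le_kdimRat (G : DirectedGraph V E) (v : V) {k : ℕ} (C : Fin k → DirectedCycle G)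
    (hv : ∀ i, (C i).Contains v)
    (hC : Pairwise fun i j => Disjoint (C i).edgeSet (C j).edgeSet) :
    (k : WithBot ℕ∞) ≤ G.kdimRat v := by
  let ψ : MvPolynomial E ℚ →ₐ[ℚ] MvPolynomial (Fin k) ℚ := MvPolynomial.aeval (cycleValue C)
  have hψ : (G.incidenceIdeal.map (MvPolynomial.map (Int.castRingHom ℚ))) ≤ RingHom.ker ψ := by
    rw [Ideal.map_le_iff_le_comap]
    intro p hp
    exact G.cycleValue_kills C hC (ψ.toRingHom.comp (MvPolynomial.map (Int.castRingHom ℚ)))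
      (fun x => by simp [ψ]) p hp
  let θ : MvPolynomial (G.incidentEdges v) ℚ →ₐ[ℚ] MvPolynomial (Fin k) ℚ :=
    ψ.comp (MvPolynomial.rename Subtype.val)
  -- Each `C i` passes through `v`, so its edge leaving `v` lies in `E(v)` and maps to `X i`.
  have hθ : Function.Surjective θ := by
    rw [← AlgHom.range_eq_top, ← top_le_iff, ← MvPolynomial.adjoin_range_X, Algebra.adjoin_le_iff]
    rintro _ ⟨i, rfl⟩
    obtain ⟨j, hj⟩ := hv i
    refine ⟨MvPolynomial.X ⟨(C i).edge j, Or.inl ((C i).init_edge j |>.trans hj)⟩, ?_⟩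
    simp [θ, ψ, cycleValue_of_mem hC (i := i) ⟨j, rfl⟩]
  have hker : ∀ a ∈ annVia (polyIncl ℚ (G.incidentEdges v)) (G.krHomologyRat 0),
      θ.toRingHom a = 0 := by
    intro a ha
    rw [annVia_rat_eq] at ha
    exact hψ ha
  have := ringKrullDim_le_of_surjective (Ideal.Quotient.lift _ θ.toRingHom hker)
    (Ideal.Quotient.lift_surjective_of_surjective _ _ hθ)
  rw [MvPolynomial.ringKrullDim_of_isNoetherianRing, ringKrullDim_eq_zero_of_field] at this
  simpa [kdimRat, krullDimVia] using this

theorem alpha_le_kdimRat (G : DirectedGraph V E) (v : V) :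
    (G.alpha v : WithBot ℕ∞) ≤ G.kdimRat v := by
  have hmem : G.alpha v ∈ {k : ℕ | ∃ C : Fin k → DirectedCycle G,
      (∀ i, (C i).Contains v) ∧ Pairwise fun i j => Disjoint (C i).edgeSet (C j).edgeSet} := by
    -- The supremum is attained because the set contains `0` and is bounded by `|E|`: disjoint
    -- cycles have distinct first edges.
    refine Nat.sSup_mem ⟨0, fun i => i.elim0, fun i => i.elim0, fun i => i.elim0⟩
      ⟨Fintype.card E, ?_⟩
    rintro k ⟨C, -, hC⟩
    have hinj : Function.Injective fun i => (C i).edge 0 := by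
      intro i j hij
      by_contra hne
      exact Set.disjoint_left.1 (hC hne) ⟨0, rfl⟩ ⟨0, hij.symm⟩
    simpa using Fintype.card_le_of_injective _ hinj
  obtain ⟨C, hv, hC⟩ := hmem
  exact G.le_kdimRat v C hv hC

theorem noCycleThrough_of_kdimRat_le_zero (G : DirectedGraph V E) (v : V)
    (h : G.kdimRat v ≤ 0) : G.NoCycleThrough v := by
  rintro ⟨C, hC⟩
  have h1 := (G.le_kdimRat v (k := 1) (fun _ => C) (fun _ => hC)
    fun i j hij => absurd (Subsingleton.elim i j) hij).trans h
  exact absurd h1 (by norm_num)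

/-- The empty family of cycles excludes the value `⊥`, that is, a zero quotient ring. -/
theorem kdimRat_nonneg (G : DirectedGraph V E) (v : V) : 0 ≤ G.kdimRat v := by
  simpa using G.le_kdimRat v (k := 0) (fun i => i.elim0) (fun i => i.elim0) (fun i => i.elim0)

theorem kdimRat_add_one_le (G : DirectedGraph V E) (v : V) : G.kdimRat v + 1 ≤ G.kdimInt v := by
  refine ringKrullDim_rat_add_one_le _ _ fun p hp => ?_
  change p ∈ G.annZero v at hp
  rw [annZero_eq, Ideal.mem_comap] at hp
  rw [annVia_rat_eq, Ideal.mem_comap, Ideal.mem_comap]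
  convert Ideal.mem_map_of_mem (MvPolynomial.map (Int.castRingHom ℚ)) hp using 1
  exact (MvPolynomial.map_rename _ _ _).symm

theorem kdimInt_le_of_finite (G : DirectedGraph V E) (v : V)
    (h : Module.Finite ℤ (MvPolynomial (G.incidentEdges v) ℤ ⧸ G.annZero v)) :
    G.kdimInt v ≤ 1 := by
  rw [← ringKrullDim_int]
  have : Algebra.IsIntegral ℤ (MvPolynomial (G.incidentEdges v) ℤ ⧸ G.annZero v) :=
    Algebra.IsIntegral.of_finite _ _
  exact ringKrullDim_le_of_isIntegral ℤ (MvPolynomial (G.incidentEdges v) ℤ ⧸ G.annZero v)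

theorem noCycleThrough_of_kdimInt_le_one (G : DirectedGraph V E) (v : V)
    (h : G.kdimInt v ≤ 1) : G.NoCycleThrough v :=
  G.noCycleThrough_of_kdimRat_le_zero v (le_of_add_one_le_one ((G.kdimRat_add_one_le v).trans h))

omit [Fintype E] [DecidableEq V] in
theorem NoCycleThrough.deleteEdges {G : DirectedGraph V E} {v : V} (h : G.NoCycleThrough v)
    (S : Set E) : (G.deleteEdges S).NoCycleThrough v := fun ⟨C, hC⟩ =>
  h ⟨⟨C.n, C.vertex, fun i => C.edge i, C.vertex_injective, C.init_edge, C.term_edge⟩, hC⟩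

theorem finite_annTotal_of_X_pow_mem (G : DirectedGraph V E) {v : V} {n : ℕ} (hn : 1 ≤ n)
    (h : ∀ x ∈ G.incidentEdges v, (MvPolynomial.X x : MvPolynomial E ℤ) ^ n ∈ G.incidenceIdeal) :
    Module.Finite ℤ (MvPolynomial (G.incidentEdges v) ℤ ⧸ G.annTotal v) :=
  finite_of_X_pow_mem _ hn fun x => G.comap_incidenceIdeal_le_annTotal v (by
    rw [Ideal.mem_comap, map_pow, polyIncl_X]
    exact h x x.2)

theorem finite_annZero_of_finite_annTotal (G : DirectedGraph V E) {v : V}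
    (h : Module.Finite ℤ (MvPolynomial (G.incidentEdges v) ℤ ⧸ G.annTotal v)) :
    Module.Finite ℤ (MvPolynomial (G.incidentEdges v) ℤ ⧸ G.annZero v) :=
  Module.Finite.of_surjective
    (Ideal.Quotient.factor (G.annTotal_le_annZero v)).toAddMonoidHom.toIntLinearMap
    (Ideal.Quotient.factor_surjective (G.annTotal_le_annZero v))

variable [Fintype V]

theorem kdimInt_le_card_add_one (G : DirectedGraph V E) (v : V) {S : Finset E}
    (hSv : (S : Set E) ⊆ G.incidentEdges v) (hS : (G.deleteEdges (S : Set E)).NoCycleThrough v) :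
    G.kdimInt v ≤ (S.card : WithBot ℕ∞) + 1 := by
  classical
  have hcard : (S.subtype (· ∈ G.incidentEdges v)).card = S.card := by
    rw [Finset.card_subtype, Finset.filter_true_of_mem fun x hx => hSv hx]
  rw [← hcard]
  refine ringKrullDim_le_card_add_one _ _ fun x => ?_
  change _ ∈ (G.annZero v).radical
  rw [annZero_eq, ← Ideal.comap_radical, Ideal.mem_comap]
  convert G.mul_prod_sub_mem_radical hS x.2 using 1
  rw [map_mul, map_prod, polyIncl_X]
  congr 1
  simp only [map_sub, polyIncl_X]
  refine Finset.prod_bij (fun s _ => (s : E)) (by simp) (by simp) (fun s hs => ?_) (by simp)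
  exact ⟨⟨s, hSv hs⟩, by simpa using hs, rfl⟩

theorem kdimInt_le_beta_add_one (G : DirectedGraph V E) (v : V) :
    G.kdimInt v ≤ (G.beta v : WithBot ℕ∞) + 1 := by
  classical
  have hmem : G.beta v ∈ {k : ℕ | ∃ S : Finset E, (S : Set E) ⊆ G.incidentEdges v ∧ S.card = k ∧
      (G.deleteEdges (S : Set E)).NoCycleThrough v} := by
    -- The infimum is attained because deleting all of `E(v)` is admissible.
    refine Nat.sInf_mem ⟨_, Finset.univ.filter (· ∈ G.incidentEdges v), by simp, rfl, ?_⟩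
    rintro ⟨C, i, hi⟩
    exact (C.edge i).2 (Finset.mem_coe.2 (Finset.mem_filter.2
      ⟨Finset.mem_univ _, Or.inl ((C.init_edge i).trans hi)⟩))
  obtain ⟨S, hSv, hcard, hS⟩ := hmem
  rw [← hcard]
  exact G.kdimInt_le_card_add_one v hSv hS

theorem kdimInt_le_one_of_noCycleThrough (G : DirectedGraph V E) {v : V}
    (h : G.NoCycleThrough v) : G.kdimInt v ≤ 1 := by
  simpa using G.kdimInt_le_card_add_one v (S := ∅) (by simp) (h.deleteEdges _)

theorem exists_X_pow_mem (G : DirectedGraph V E) {v : V} (h : G.NoCycleThrough v) :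
    ∃ n : ℕ, 1 ≤ n ∧ ∀ x ∈ G.incidentEdges v,
      (MvPolynomial.X x : MvPolynomial E ℤ) ^ n ∈ G.incidenceIdeal := by
  -- Noetherianity gives one exponent for all edges; passing to `n + 1` ensures that it is positive.
  obtain ⟨n, hn⟩ := Ideal.exists_radical_pow_le_of_fg G.incidenceIdeal (IsNoetherian.noetherian _)
  refine ⟨n + 1, by omega, fun x hx => ?_⟩
  rw [pow_succ]
  refine Ideal.mul_mem_right _ _ (hn (Ideal.pow_mem_pow ?_ n))
  simpa using G.mul_prod_sub_mem_radical (S := ∅) (h.deleteEdges _) hx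

end DirectedGraph

theorem mainTheorem5 {V : Type u} {E : Type w} [Fintype V] [Fintype E] [DecidableEq V]
    (G : DirectedGraph V E) (v : V) :
    List.TFAE [
      G.NoCycleThrough v,
      Module.Finite ℤ (MvPolynomial (G.incidentEdges v) ℤ ⧸ G.annZero v),
      Module.Finite ℤ (MvPolynomial (G.incidentEdges v) ℤ ⧸ G.annTotal v),
      ∃ n : ℕ, 1 ≤ n ∧ ∀ x ∈ G.incidentEdges v,
        (MvPolynomial.X x : MvPolynomial E ℤ) ^ n ∈ G.incidenceIdeal,
      G.kdimInt v = 1,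
      G.kdimRat v = 0] ∧
    (G.alpha v : WithBot ℕ∞) ≤ G.kdimRat v ∧
    G.kdimRat v + 1 ≤ G.kdimInt v ∧
    G.kdimInt v ≤ (G.beta v : WithBot ℕ∞) + 1 := by
  refine ⟨?_, G.alpha_le_kdimRat v, G.kdimRat_add_one_le v, G.kdimInt_le_beta_add_one v⟩
  tfae_have 1 → 4 := G.exists_X_pow_mem
  tfae_have 4 → 3 := fun ⟨_, hn, h⟩ => G.finite_annTotal_of_X_pow_mem hn h
  tfae_have 3 → 2 := G.finite_annZero_of_finite_annTotal
  tfae_have 2 → 1 := fun h => G.noCycleThrough_of_kdimInt_le_one v (G.kdimInt_le_of_finite v h)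
  tfae_have 1 → 5 := fun h => (G.kdimInt_le_one_of_noCycleThrough h).antisymm <| by
    simpa using (add_le_add_left (G.kdimRat_nonneg v) 1).trans (G.kdimRat_add_one_le v)
  tfae_have 5 → 1 := fun h => G.noCycleThrough_of_kdimInt_le_one v h.le
  tfae_have 1 → 6 := fun h => (le_of_add_one_le_one ((G.kdimRat_add_one_le v).trans
    (G.kdimInt_le_one_of_noCycleThrough h))).antisymm (G.kdimRat_nonneg v)
  tfae_have 6 → 1 := fun h => G.noCycleThrough_of_kdimRat_le_zero v h.le
  tfae_finish
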